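/- Let $\mathbb{K}$ be an uncountable algebraically closed field of characteristic zero. An irreducible affine variety over $\mathbb{K}$ is called toral if it is isomorphic to a closed subvariety of a torus $T_d=(\mathbb{K}^*)^d$ for some $d$. For an affine variety $Y$ let $\mathbb{K}[Y]^*$ be the group of invertible regular functions on $Y$, let $E(Y)=\mathbb{K}[Y]^*/\mathbb{K}^*$, and let $\mathrm{Aut}(Y)$ be the group of regular automorphisms of $Y$; it is called discrete if its Zariski (ind-group) topology is discrete, i.e. the topology in which a subset is closed if and only if its preimage under every algebraic family $Z\to\mathrm{Aut}(Y)$ of automorphisms parametrized by an affine variety $Z$ is Zariski-closed in $Z$. Let $Y$ be a toral variety with $\mathrm{Aut}(Y)$ discrete, let $s\ge 0$, and let $X$ be a variety isomorphic to $T_s\times Y$ (then $X$ is toral as well). Then the extension $1\to\mathbb{K}^*\to\mathbb{K}[Y]^*\to E(Y)\to 1$ splits, so that $\mathbb{K}[Y]^*\cong E(Y)\times\mathbb{K}^*$, and for every such splitting there is an isomorphism of groups $$\mathrm{Aut}(X)\;\cong\;\mathrm{Aut}(Y)\ltimes\bigl(\mathrm{GL}_s(\mathbb{Z})\ltimes(E(Y)\times\mathbb{K}^*)^s\bigr).$$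 Here $A=(a_{ij})\in\mathrm{GL}_s(\mathbb{Z})$ acts on $(E(Y)\times\mathbb{K}^*)^s$ by $(m_i)_i\mapsto\bigl(\prod_j m_j^{a_{ij}}\bigr)_i$; the group $\mathrm{Aut}(Y)$ acts trivially on $\mathrm{GL}_s(\mathbb{Z})$ and acts on each factor $E(Y)\times\mathbb{K}^*\cong\mathbb{K}[Y]^*$ by $(g\cdot f)(y)=f(g^{-1}y)$. Under this isomorphism, and identifying $X$ with $T_s\times Y$, an element $g\in\mathrm{Aut}(Y)$ corresponds to the automorphism $(t,y)\mapsto(t,g(y))$, a matrix $A\in\mathrm{GL}_s(\mathbb{Z})$ to $(t,y)\mapsto\bigl(\bigl(\prod_j t_j^{a_{ij}}\bigr)_i,\,y\bigr)$, and $(f_1,\dots,f_s)\in(\mathbb{K}[Y]^*)^s\cong(E(Y)\times\mathbb{K}^*)^s$ to $$(t,y)\mapsto(f_1(y)t_1,\dots,f_s(y)t_s,\,y).$$ -/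

import Mathlib

universe u v w

/-- An affine variety over an (algebraically closed) field `K`, given by its set of points `X`
together with its algebra `K[X]` of regular functions: a finitely generated algebra of `K`-valued
functions on `X` such that the points of `X` are exactly the `K`-algebra homomorphisms
`K[X] → K`. Equivalently, generators of `K[X]` identify `X` with a Zariski-closed subset of `K^n`
and `K[X]` with the restrictions of polynomials to it. -/
class AffineVariety (K : Type u) [Field K] (X : Type v) where
  /-- The algebra `K[X]` of regular functions. -/
  regular : Subalgebra K (X → K)
  fg : regular.FG
  points_bijective : Function.Bijective
    (fun x : X => ((Pi.evalAlgHom K (fun _ : X => K) x).comp regular.val : regular →ₐ[K] K))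

namespace AffineVariety

section Basic

variable (K : Type u) [Field K]

/-- `φ : X → Y` is a morphism of affine varieties. -/
def IsRegularMap {X : Type v} {Y : Type w} [AffineVariety K X] [AffineVariety K Y]
    (φ : X → Y) : Prop :=
  ∀ f ∈ regular (K := K) (X := Y), f ∘ φ ∈ regular (K := K) (X := X)

/-- Zariski-closed subsets: common zero sets of regular functions. -/
def IsZariskiClosed {X : Type v} [AffineVariety K X] (Z : Set X) : Prop :=
  ∃ S : Set (X → K), S ⊆ regular (K := K) (X := X) ∧ Z = {x | ∀ f ∈ S, f x = 0}

/-- The Zariski topology of an affine variety. -/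
@[reducible] def zariskiTopology (X : Type v) [AffineVariety K X] : TopologicalSpace X :=
  TopologicalSpace.ofClosed {Z : Set X | IsZariskiClosed K Z}
    ⟨{1}, by simp, by ext x; simp⟩
    (by
      intro A hA
      refine ⟨{f | f ∈ regular (K := K) (X := X) ∧ ∃ Z ∈ A, ∀ x ∈ Z, f x = 0},
        fun f hf => hf.1, ?_⟩
      ext x
      constructor
      · rintro hx f ⟨-, Z, hZ, hfZ⟩
        exact hfZ x (hx Z hZ)
      · intro hx Z hZ
        obtain ⟨S, hS, rfl⟩ := hA hZ
        intro f hf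
        exact hx f ⟨hS hf, _, hZ, fun y hy => hy f hf⟩)
    (by
      rintro _ ⟨S, hS, rfl⟩ _ ⟨T, hT, rfl⟩
      refine ⟨{h | ∃ f ∈ S, ∃ g ∈ T, h = f * g}, ?_, ?_⟩
      · rintro _ ⟨f, hf, g, hg, rfl⟩
        exact Subalgebra.mul_mem _ (hS hf) (hT hg)
      · ext x
        constructor
        · rintro (hx | hx) _ ⟨f, hf, g, hg, rfl⟩
          · simp [hx f hf]
          · simp [hx g hg]
        · intro hx
          by_contra hne
          rw [Set.mem_union, not_or] at hne
          obtain ⟨h1, h2⟩ := hne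
          simp only [Set.mem_ofPred_eq, not_forall] at h1 h2
          obtain ⟨f, hf, hfx⟩ := h1
          obtain ⟨g, hg, hgx⟩ := h2
          have := hx (f * g) ⟨f, hf, g, hg, rfl⟩
          simp only [Pi.mul_apply, mul_eq_zero] at this
          exact this.elim hfx hgx)

/-- Irreducibility in the Zariski topology (an irreducible variety is non-empty). -/
def IsIrreducibleVariety (X : Type v) [AffineVariety K X] : Prop :=
  @IrreducibleSpace X (zariskiTopology K X)

/-- `ι : X → Y` is an isomorphism of `X` onto a closed subvariety of `Y`: it is injective, its
image is Zariski-closed, and the regular functions on `X` are exactly the functions `f ∘ ι` with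
`f` regular on `Y`. -/
structure IsClosedImmersion {X : Type v} {Y : Type w} [AffineVariety K X] [AffineVariety K Y]
    (ι : X → Y) : Prop where
  injective : Function.Injective ι
  closed_range : IsZariskiClosed K (Set.range ι)
  regular_iff : ∀ h : X → K, h ∈ regular (K := K) (X := X) ↔
    ∃ f ∈ regular (K := K) (X := Y), h = f ∘ ι

/-- The points of the torus `T_s = (K^*)^s`. -/
abbrev Torus (s : ℕ) : Type u := Fin s → Kˣ

/-- The torus as an affine variety: its regular functions are the Laurent polynomials in the
coordinates. -/
instance torusVariety (s : ℕ) : AffineVariety K (Torus K s) where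
  regular := Algebra.adjoin K
    (Set.range (fun (i : Fin s) (t : Torus K s) => (t i : K)) ∪
      Set.range (fun (i : Fin s) (t : Torus K s) => ((t i)⁻¹ : K)))
  fg := Subalgebra.fg_def.2 ⟨_, (Set.finite_range _).union (Set.finite_range _), rfl⟩
  points_bijective := by
    constructor
    · intro x y hxy
      funext i
      ext
      exact DFunLike.congr_fun hxy
        ⟨_, Algebra.subset_adjoin (Or.inl ⟨i, rfl⟩)⟩
    · intro χ
      have h1 : ∀ i, χ ⟨_, Algebra.subset_adjoin (Or.inl ⟨i, rfl⟩)⟩ *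
          χ ⟨_, Algebra.subset_adjoin (Or.inr ⟨i, rfl⟩)⟩ = 1 := by
        intro i
        rw [← map_mul, ← map_one χ]
        congr 1
        ext t
        simp
      refine ⟨fun i => Units.mkOfMulEqOne _ _ (h1 i), ?_⟩
      refine AlgHom.adjoin_ext ?_
      rintro _ (⟨i, rfl⟩ | ⟨i, rfl⟩)
      · rfl
      · simpa using inv_eq_of_mul_eq_one_right (h1 i)

/-- Pulling back functions along a map of sets. -/
def pullback {X : Type v} {Y : Type w} (φ : X → Y) : (Y → K) →ₐ[K] (X → K) :=
  AlgHom.pi (fun x => Pi.evalAlgHom K (fun _ : Y => K) (φ x))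

/-- The product of two affine varieties: its regular functions are generated by those pulled back
from the factors, so `K[X × Y] = K[X] ⊗ K[Y]`. -/
instance prodVariety (X : Type v) (Y : Type w) [AffineVariety K X] [AffineVariety K Y] :
    AffineVariety K (X × Y) where
  regular := Algebra.adjoin K
    (pullback K (Prod.fst : X × Y → X) '' (regular (K := K) (X := X)) ∪
      pullback K (Prod.snd : X × Y → Y) '' (regular (K := K) (X := Y)))
  fg := by
    rw [Algebra.adjoin_union, ← AlgHom.map_adjoin, ← AlgHom.map_adjoin, Algebra.adjoin_eq,
      Algebra.adjoin_eq]
    exact (fg.map _).sup (fg.map _)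
  points_bijective := by
    constructor
    · rintro ⟨x, y⟩ ⟨x', y'⟩ h
      refine Prod.ext ((points_bijective (K := K) (X := X)).1 ?_)
        ((points_bijective (K := K) (X := Y)).1 ?_)
      · ext f
        exact DFunLike.congr_fun h ⟨_, Algebra.subset_adjoin (Or.inl ⟨f.1, f.2, rfl⟩)⟩
      · ext f
        exact DFunLike.congr_fun h ⟨_, Algebra.subset_adjoin (Or.inr ⟨f.1, f.2, rfl⟩)⟩
    · intro χ
      obtain ⟨x, hx⟩ := (points_bijective (K := K) (X := X)).2
        (χ.comp (((pullback K (Prod.fst : X × Y → X)).comp (regular (K := K) (X := X)).val).codRestrict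
          _ (fun f => Algebra.subset_adjoin (Or.inl ⟨f.1, f.2, rfl⟩))))
      obtain ⟨y, hy⟩ := (points_bijective (K := K) (X := Y)).2
        (χ.comp (((pullback K (Prod.snd : X × Y → Y)).comp (regular (K := K) (X := Y)).val).codRestrict
          _ (fun f => Algebra.subset_adjoin (Or.inr ⟨f.1, f.2, rfl⟩))))
      refine ⟨(x, y), AlgHom.adjoin_ext ?_⟩
      rintro _ (⟨f, hf, rfl⟩ | ⟨f, hf, rfl⟩)
      · exact DFunLike.congr_fun hx ⟨f, hf⟩
      · exact DFunLike.congr_fun hy ⟨f, hf⟩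

/-- A toral variety: an irreducible affine variety isomorphic to a closed subvariety of a torus. -/
def IsToral (X : Type v) [AffineVariety K X] : Prop :=
  IsIrreducibleVariety K X ∧ ∃ (d : ℕ) (ι : X → Torus K d), IsClosedImmersion K ι

end Basic

section Automorphisms

variable (K : Type u) [Field K]

/-- The group `Aut(X)` of regular automorphisms of an affine variety. -/
def Aut (X : Type v) [AffineVariety K X] : Subgroup (Equiv.Perm X) where
  carrier := {g | IsRegularMap K g ∧ IsRegularMap K g.symm}
  one_mem' := ⟨fun _ hf => hf, fun _ hf => hf⟩
  mul_mem' := fun ha hb =>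
    ⟨fun f hf => hb.1 _ (ha.1 f hf), fun f hf => ha.2 _ (hb.2 f hf)⟩
  inv_mem' := fun ha => ⟨ha.2, ha.1⟩

/-- An algebraic family of automorphisms of `X` parametrized by an affine variety `Z`: a map
`φ : Z → Aut(X)` such that `(z, x) ↦ φ_z(x)` and `(z, x) ↦ φ_z⁻¹(x)` are morphisms
`Z × X → X`. -/
def IsAlgebraicFamily {X : Type v} [AffineVariety K X] {Z : Type w} [AffineVariety K Z]
    (φ : Z → Aut K X) : Prop :=
  IsRegularMap K (fun p : Z × X => (φ p.1 : Equiv.Perm X) p.2) ∧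
    IsRegularMap K (fun p : Z × X => (φ p.1 : Equiv.Perm X).symm p.2)

/-- The Zariski topology of the ind-group `Aut(X)`: a set is open (closed) if and only if its
preimage under every algebraic family parametrized by an affine variety is Zariski-open (closed).
Every affine variety over `K` is isomorphic to one whose set of points lies in the universe of
`K`. -/
@[reducible] def autTopology (X : Type v) [AffineVariety K X] : TopologicalSpace (Aut K X) where
  IsOpen U := ∀ (Z : Type u) [AffineVariety K Z] (φ : Z → Aut K X), IsAlgebraicFamily K φ →
    @IsOpen Z (zariskiTopology K Z) (φ ⁻¹' U)
  isOpen_univ := fun Z _ _ _ => @isOpen_univ Z (zariskiTopology K Z)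
  isOpen_inter := fun U V hU hV Z _ φ hφ =>
    let _ := zariskiTopology K Z
    (hU Z φ hφ).inter (hV Z φ hφ)
  isOpen_sUnion := fun S hS Z _ φ hφ => by
    let _ := zariskiTopology K Z
    rw [Set.preimage_sUnion]
    exact isOpen_biUnion (fun U hU => hS U hU Z φ hφ)

/-- The automorphism group of `X` is discrete. -/
def HasDiscreteAut (X : Type v) [AffineVariety K X] : Prop :=
  @DiscreteTopology (Aut K X) (autTopology K X)

end Automorphisms

section Units

variable (K : Type u) [Field K] (Y : Type v) [AffineVariety K Y]

/-- The group `K[Y]^*` of invertible regular functions. -/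
abbrev RegularUnits : Type (max u v) := (regular (K := K) (X := Y))ˣ

/-- The inclusion `K^* → K[Y]^*` of the constants. -/
def constUnits : Kˣ →* RegularUnits K Y :=
  Units.map (algebraMap K (regular (K := K) (X := Y))).toMonoidHom

/-- The group `E(Y) = K[Y]^* / K^*`. -/
def UnitClassGroup : Type (max u v) := RegularUnits K Y ⧸ (constUnits K Y).range

instance : CommGroup (UnitClassGroup K Y) :=
  inferInstanceAs (CommGroup (RegularUnits K Y ⧸ (constUnits K Y).range))

/-- The class `[f] ∈ E(Y)` of an invertible regular function. -/
def unitClass : RegularUnits K Y →* UnitClassGroup K Y :=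
  QuotientGroup.mk' (constUnits K Y).range

variable {K Y}

/-- The value `f(y) ∈ K^*` of an invertible regular function `f` at a point `y`. -/
def evalUnit (f : RegularUnits K Y) (y : Y) : Kˣ :=
  Units.map
    ((Pi.evalAlgHom K (fun _ : Y => K) y).comp (regular (K := K) (X := Y)).val :
      regular (K := K) (X := Y) →* K) f

variable (K Y)

/-- The action of `Aut(Y)` on `K[Y]^*`, `(g • f)(y) = f(g⁻¹ y)`. -/
def autUnits : Aut K Y →* MulAut (RegularUnits K Y) where
  toFun g := Units.mapEquiv
    { toFun := fun f => ⟨f.1 ∘ (g : Equiv.Perm Y).symm, g.2.2 f.1 f.2⟩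
      invFun := fun f => ⟨f.1 ∘ (g : Equiv.Perm Y), g.2.1 f.1 f.2⟩
      left_inv := fun f => by ext y; simp
      right_inv := fun f => by ext y; simp
      map_mul' := fun _ _ => rfl }
  map_one' := rfl
  map_mul' _ _ := rfl

/-- A splitting of the extension `1 → K^* → K[Y]^* → E(Y) → 1`: an isomorphism
`K[Y]^* ≃ E(Y) × K^*` whose first component is the quotient map and which sends a constant `c` to
`(1, c)`. -/
def IsSplitting (σ : RegularUnits K Y ≃* UnitClassGroup K Y × Kˣ) : Prop :=
  (∀ f, (σ f).1 = unitClass K Y f) ∧ ∀ c, σ (constUnits K Y c) = (1, c)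

/-- The action of `Aut(Y)` on `E(Y) × K^*` obtained from its action on `K[Y]^*` through an
isomorphism `σ : K[Y]^* ≃ E(Y) × K^*`. -/
def autSplit (σ : RegularUnits K Y ≃* UnitClassGroup K Y × Kˣ) :
    Aut K Y →* MulAut (UnitClassGroup K Y × Kˣ) :=
  (MulAut.congr σ).toMonoidHom.comp (autUnits K Y)

end Units

section Semidirect

/-- The endomorphism `m ↦ (∏_j m_j ^ a_{ij})_i` of `M^s` given by an integral matrix. -/
def matrixPow {s : ℕ} {M : Type v} [CommGroup M] (A : Matrix (Fin s) (Fin s) ℤ) (m : Fin s → M) :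
    Fin s → M :=
  fun i => ∏ j, m j ^ A i j

lemma matrixPow_one {s : ℕ} {M : Type v} [CommGroup M] (m : Fin s → M) :
    matrixPow 1 m = m := by
  funext i
  rw [matrixPow, Finset.prod_eq_single i]
  · simp
  · intro j _ hj
    simp [Matrix.one_apply_ne hj.symm]
  · simp

lemma matrixPow_mul {s : ℕ} {M : Type v} [CommGroup M] (A B : Matrix (Fin s) (Fin s) ℤ)
    (m : Fin s → M) : matrixPow (A * B) m = matrixPow A (matrixPow B m) := by
  funext i
  have h : ∀ (a : M) (f : Fin s → ℤ), a ^ (∑ j, f j) = ∏ j, a ^ f j := fun a f =>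
    map_prod (zpowersHom M a) (fun j => Multiplicative.ofAdd (f j)) Finset.univ
  simp only [matrixPow, Matrix.mul_apply, h, ← Finset.prod_zpow, ← zpow_mul]
  rw [Finset.prod_comm]
  simp only [mul_comm]

/-- The action of `GL_s(ℤ)` on `M^s`, for an abelian group `M` written multiplicatively:
`(A • m)_i = ∏_j m_j ^ a_{ij}`. -/
def glAction (s : ℕ) (M : Type v) [CommGroup M] : GL (Fin s) ℤ →* MulAut (Fin s → M) where
  toFun A :=
    { toFun := matrixPow A.1
      invFun := matrixPow (A⁻¹).1
      left_inv := fun m => by rw [← matrixPow_mul, ← Units.val_mul, inv_mul_cancel, Units.val_one,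
        matrixPow_one]
      right_inv := fun m => by rw [← matrixPow_mul, ← Units.val_mul, mul_inv_cancel,
        Units.val_one, matrixPow_one]
      map_mul' := fun m n => by
        funext i
        simp [matrixPow, mul_zpow, Finset.prod_mul_distrib] }
  map_one' := by
    ext m
    simp [matrixPow_one]
  map_mul' A B := by
    ext m
    simp [matrixPow_mul]

/-- The semidirect product `GL_s(ℤ) ⋉ M^s`. -/
abbrev GLSemidirect (s : ℕ) (M : Type v) [CommGroup M] : Type v :=
  (Fin s → M) ⋊[glAction s M] GL (Fin s) ℤ

/-- An action `a` of a group `G` on an abelian group `M` induces an action of `G` on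
`GL_s(ℤ) ⋉ M^s`: coordinatewise on `M^s` and trivial on `GL_s(ℤ)`. -/
def inducedAction (s : ℕ) {M : Type v} [CommGroup M] {G : Type w} [Group G] (a : G →* MulAut M) :
    G →* MulAut (GLSemidirect s M) where
  toFun g := SemidirectProduct.congr (MulEquiv.piCongrRight fun _ => a g) (MulEquiv.refl _)
    (fun A => by
      ext m i
      simp [glAction, matrixPow])
  map_one' := by
    ext x <;> simp
  map_mul' g h := by
    ext x <;> simp

end Semidirect
end AffineVariety

open AffineVariety

/-!
# Automorphisms of the product of a torus and a toral variety with discrete automorphism group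

Evaluation at a point of `Y` retracts `K[Y]^*` onto `K^*`, which gives the splitting
(`exists_isSplitting`).

For the automorphism group, identify `K[T_s × Y]` with the Laurent polynomial ring `K[Y][ℤ^s]`.
Since `K[Y]` is a domain, so is this ring, and its units are the monomials `u(y) t^m` with
`u ∈ K[Y]^*` (`exists_eq_evalUnit_mul_torusCharacter`). Let `F` be an automorphism of `T_s × Y`.
Its torus coordinates are units, hence of the form `f_i(y) t^{A_i}`. Let `h` be its `Y`-component
and embed `Y` in a torus `T_d` by `ι`. The coordinates of `ι ∘ h` are again units, so
`ι(h(t, y))_k = v_k(y) t^{B_k}`, and therefore translation by `(τ^{B_k})_k` maps `ι(h(t, y))` to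
`ι(h(τ t, y))`. As `h` is surjective, these translations preserve `Y`, and they form an algebraic
family `T_s → Aut(Y)`. Discreteness of `Aut(Y)` makes the set of `τ` acting trivially open; it
contains `1` and `T_s` is irreducible, so the characters `τ^{B_k}` are trivial
(`torusCharacter_eq_one_of_hasDiscreteAut`) and `h` does not depend on `t`. This is the normal form
`exists_normal_form`. Comparing the normal forms of `F` and `F⁻¹` shows that the matrix `A` is
invertible over `ℤ` and that `h` is an automorphism of `Y` (`exists_eq_normalMap`). Finally,
composition of normal forms is multiplication in the semidirect product (`normalAction_mul`), and
independence of characters shows that a normal form determines its data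
(`normalMap_injective`).
-/

namespace AffineVariety

/-! ### Regular maps and invertible functions -/

section RegularMaps

variable (K : Type u) [Field K]

variable {K} in
theorem IsRegularMap.comp {X Y Z : Type*} [AffineVariety K X] [AffineVariety K Y]
    [AffineVariety K Z] {ψ : Y → Z} {φ : X → Y} (hψ : IsRegularMap K ψ) (hφ : IsRegularMap K φ) :
    IsRegularMap K (ψ ∘ φ) :=
  fun f hf => hφ _ (hψ f hf)

/-- The subgroup of those functions `X → K^*` that are invertible regular functions; it is
`K[X]^*`, seen inside the group of all `K^*`-valued functions. -/
def regularUnitSubgroup (X : Type v) [AffineVariety K X] : Subgroup (X → Kˣ) where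
  carrier := {P | (fun x => (P x : K)) ∈ regular (K := K) (X := X) ∧
    (fun x => ((P x)⁻¹ : Kˣ).1) ∈ regular (K := K) (X := X)}
  one_mem' := by
    constructor
    · exact (regular (K := K) (X := X)).one_mem
    · convert (regular (K := K) (X := X)).one_mem using 1
      ext x
      simp
  mul_mem' := fun {P Q} hP hQ => by
    refine ⟨mul_mem hP.1 hQ.1, ?_⟩
    have h := mul_mem hP.2 hQ.2
    convert h using 1
    ext x
    simp [mul_comm]
  inv_mem' := fun {P} hP => ⟨hP.2, by simpa using hP.1⟩

variable {K}
variable {X : Type v} {Y : Type w} [AffineVariety K X] [AffineVariety K Y]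

theorem evalUnit_mem (f : RegularUnits K Y) : evalUnit f ∈ regularUnitSubgroup K Y :=
  ⟨f.1.2, (f⁻¹).1.2⟩

theorem exists_evalUnit_eq {P : Y → Kˣ} (hP : P ∈ regularUnitSubgroup K Y) :
    ∃ f : RegularUnits K Y, evalUnit f = P := by
  refine ⟨⟨⟨_, hP.1⟩, ⟨_, hP.2⟩, ?_, ?_⟩, ?_⟩
  · ext y; simp
  · ext y; simp
  · ext y; rfl

/-- Evaluation `K[Y]^* → K^*` at a point, as a group homomorphism. -/
def evalUnitHom (y : Y) : RegularUnits K Y →* Kˣ where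
  toFun f := evalUnit f y
  map_one' := by ext; rfl
  map_mul' _ _ := by ext; rfl

theorem evalUnit_mul (f g : RegularUnits K Y) (y : Y) :
    evalUnit (f * g) y = evalUnit f y * evalUnit g y :=
  map_mul (evalUnitHom y) f g

theorem evalUnit_injective : Function.Injective (evalUnit : RegularUnits K Y → Y → Kˣ) := by
  intro f g h
  ext y
  exact congrArg Units.val (congrFun h y)

theorem evalUnit_constUnits (c : Kˣ) (y : Y) : evalUnit (constUnits K Y c) y = c := by
  ext; rfl

theorem evalUnit_autUnits (g : Aut K Y) (f : RegularUnits K Y) (y : Y) :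
    evalUnit (autUnits K Y g f) y = evalUnit f ((g : Equiv.Perm Y).symm y) := by
  ext; rfl

theorem comp_mem_regularUnitSubgroup {φ : X → Y} (hφ : IsRegularMap K φ) {P : Y → Kˣ}
    (hP : P ∈ regularUnitSubgroup K Y) : P ∘ φ ∈ regularUnitSubgroup K X :=
  ⟨hφ _ hP.1, hφ _ hP.2⟩

theorem coordinate_mem_regularUnitSubgroup {s : ℕ} (i : Fin s) :
    (fun t : Torus K s => t i) ∈ regularUnitSubgroup K (Torus K s) := by
  refine ⟨Algebra.subset_adjoin (Or.inl ⟨i, rfl⟩), Algebra.subset_adjoin (Or.inr ⟨i, ?_⟩)⟩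
  ext t
  simp

theorem isRegularMap_of_generators {φ : X → Y} {S : Set (Y → K)}
    (hS : regular (K := K) (X := Y) = Algebra.adjoin K S)
    (h : ∀ f ∈ S, f ∘ φ ∈ regular (K := K) (X := X)) : IsRegularMap K φ := by
  intro f hf
  rw [hS] at hf
  induction hf using Algebra.adjoin_induction with
  | mem f hf => exact h f hf
  | algebraMap r => exact (regular (K := K) (X := X)).algebraMap_mem r
  | add f g _ _ hf hg => exact add_mem hf hg
  | mul f g _ _ hf hg => exact mul_mem hf hg

theorem isRegularMap_torus_iff {s : ℕ} {φ : X → Torus K s} :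
    IsRegularMap K φ ↔ ∀ i, (fun x => φ x i) ∈ regularUnitSubgroup K X := by
  constructor
  · intro h i
    exact comp_mem_regularUnitSubgroup h (coordinate_mem_regularUnitSubgroup i)
  · intro h
    refine isRegularMap_of_generators rfl ?_
    rintro _ (⟨i, rfl⟩ | ⟨i, rfl⟩)
    · exact (h i).1
    · convert (h i).2 using 1
      ext x
      simp

theorem isRegularMap_fst : IsRegularMap K (Prod.fst : X × Y → X) :=
  fun f hf => Algebra.subset_adjoin (Or.inl ⟨f, hf, rfl⟩)

theorem isRegularMap_snd : IsRegularMap K (Prod.snd : X × Y → Y) :=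
  fun f hf => Algebra.subset_adjoin (Or.inr ⟨f, hf, rfl⟩)

theorem isRegularMap_prodMk {Z : Type*} [AffineVariety K Z] {φ : Z → X} {ψ : Z → Y}
    (hφ : IsRegularMap K φ) (hψ : IsRegularMap K ψ) :
    IsRegularMap K (fun z => (φ z, ψ z)) := by
  refine isRegularMap_of_generators rfl ?_
  rintro _ (⟨f, hf, rfl⟩ | ⟨f, hf, rfl⟩)
  · exact hφ f hf
  · exact hψ f hf

theorem isRegularMap_id : IsRegularMap K (fun x : X => x) := fun _ hf => hf

theorem isRegularMap_const (y : Y) : IsRegularMap K (fun _ : X => y) :=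
  fun f _ => (regular (K := K) (X := X)).algebraMap_mem (f y)

theorem IsClosedImmersion.isRegularMap {ι : X → Y} (hι : IsClosedImmersion K ι) :
    IsRegularMap K ι :=
  fun f hf => (hι.regular_iff _).2 ⟨f, hf, rfl⟩

theorem IsClosedImmersion.isRegularMap_of_comp {Z : Type*} [AffineVariety K Z] {ι : X → Y}
    (hι : IsClosedImmersion K ι) {φ : Z → X} (h : IsRegularMap K (ι ∘ φ)) : IsRegularMap K φ := by
  intro f hf
  obtain ⟨f', hf', rfl⟩ := (hι.regular_iff f).1 hf
  exact h f' hf'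

end RegularMaps

/-! ### Irreducible varieties and the splitting of the unit group -/

section Irreducible

variable {K : Type u} [Field K] {Y : Type w} [AffineVariety K Y]

theorem isClosed_zariskiTopology_iff {Z : Set Y} :
    @IsClosed Y (zariskiTopology K Y) Z ↔ IsZariskiClosed K Z := by
  rw [← @isOpen_compl_iff Y Z (zariskiTopology K Y)]
  change IsZariskiClosed K (Zᶜᶜ) ↔ _
  rw [compl_compl]

theorem IsIrreducibleVariety.nonempty (hY : IsIrreducibleVariety K Y) : Nonempty Y :=
  @IrreducibleSpace.toNonempty Y (zariskiTopology K Y) hY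

theorem IsIrreducibleVariety.isDomain (hY : IsIrreducibleVariety K Y) :
    IsDomain (regular (K := K) (X := Y)) := by
  have hne := hY.nonempty
  have hclosed : ∀ f : regular (K := K) (X := Y),
      @IsClosed Y (zariskiTopology K Y) {y | f.1 y = 0} := fun f =>
    isClosed_zariskiTopology_iff.2 ⟨{f.1}, by simp, by simp⟩
  have : NoZeroDivisors (regular (K := K) (X := Y)) := by
    refine ⟨fun {f g} hfg => ?_⟩
    have hpre := @PreirreducibleSpace.isPreirreducible_univ Y (zariskiTopology K Y)
      hY.toPreirreducibleSpace
    rw [@isPreirreducible_iff_isClosed_union_isClosed Y (zariskiTopology K Y)] at hpre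
    refine (hpre _ _ (hclosed f) (hclosed g) fun y _ => ?_).imp (fun h => ?_) (fun h => ?_)
    · have := congrFun (congrArg Subtype.val hfg) y
      simpa using this
    · ext y; exact h (Set.mem_univ y)
    · ext y; exact h (Set.mem_univ y)
  have : Nontrivial (regular (K := K) (X := Y)) := by
    refine ⟨0, 1, fun h => ?_⟩
    obtain ⟨y⟩ := hne
    simpa using congrFun (congrArg Subtype.val h) y
  exact NoZeroDivisors.to_isDomain _

/-- Evaluation at a point splits the extension `1 → K^* → K[Y]^* → E(Y) → 1`. -/
theorem exists_isSplitting [Nonempty Y] :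
    ∃ σ : RegularUnits K Y ≃* UnitClassGroup K Y × Kˣ, IsSplitting K Y σ := by
  obtain ⟨y⟩ := ‹Nonempty Y›
  let φ := (unitClass K Y).prod (evalUnitHom y)
  have hker : ∀ c, unitClass K Y (constUnits K Y c) = 1 := fun c =>
    (QuotientGroup.eq_one_iff _).2 ⟨c, rfl⟩
  have hφ : Function.Bijective φ := by
    constructor
    · rw [injective_iff_map_eq_one]
      intro f hf
      obtain ⟨c, rfl⟩ := (QuotientGroup.eq_one_iff f).1 (congrArg Prod.fst hf)
      have h2 : evalUnit (constUnits K Y c) y = 1 := congrArg Prod.snd hf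
      rw [evalUnit_constUnits] at h2
      rw [h2, map_one]
    · rintro ⟨q, c⟩
      obtain ⟨f, rfl⟩ := QuotientGroup.mk'_surjective _ q
      refine ⟨f * constUnits K Y ((evalUnit f y)⁻¹ * c), Prod.ext ?_ ?_⟩
      · change unitClass K Y (f * _) = unitClass K Y f
        rw [map_mul, hker, mul_one]
      · change evalUnit (f * _) y = c
        rw [evalUnit_mul, evalUnit_constUnits]
        exact mul_inv_cancel_left _ _
  refine ⟨MulEquiv.ofBijective φ hφ, fun f => rfl, fun c => Prod.ext (hker c) ?_⟩
  exact evalUnit_constUnits c y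

end Irreducible

/-! ### Laurent polynomials and the units of `K[T_s × Y]` -/

section Laurent

variable (K : Type u) [Field K] {s : ℕ}

/-- The character `t ↦ ∏_j t_j ^ m_j` of the torus. -/
def torusCharacter (m : Fin s → ℤ) : Torus K s →* Kˣ where
  toFun t := ∏ j, t j ^ m j
  map_one' := by simp
  map_mul' t t' := by simp [mul_zpow, Finset.prod_mul_distrib]

variable {K}

theorem torusCharacter_apply (m : Fin s → ℤ) (t : Torus K s) :
    torusCharacter K m t = ∏ j, t j ^ m j := rfl

theorem torusCharacter_zero : torusCharacter K (0 : Fin s → ℤ) = 1 := by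
  ext t; simp [torusCharacter_apply]

theorem torusCharacter_add (m n : Fin s → ℤ) :
    torusCharacter K (m + n) = torusCharacter K m * torusCharacter K n := by
  ext t; simp [torusCharacter_apply, zpow_add, Finset.prod_mul_distrib]

theorem torusCharacter_single (i : Fin s) (t : Torus K s) :
    torusCharacter K (Pi.single i 1) t = t i := by
  rw [torusCharacter_apply, Finset.prod_eq_single i]
  · simp
  · intro j _ hj; simp [hj]
  · simp

theorem torusCharacter_injective [CharZero K] :
    Function.Injective (torusCharacter K : (Fin s → ℤ) → Torus K s →* Kˣ) := by
  have key : ∀ (m : Fin s → ℤ) (i : Fin s) (c : Kˣ),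
      torusCharacter K m (Pi.mulSingle i c) = c ^ m i := by
    intro m i c
    rw [torusCharacter_apply, Finset.prod_eq_single i]
    · simp
    · intro j _ hj; simp [hj]
    · simp
  intro m n h
  ext i
  have h2 := congrArg Units.val
    (DFunLike.congr_fun h (Pi.mulSingle i (Units.mk0 (2 : K) two_ne_zero)))
  rw [key, key] at h2
  simp only [Units.val_zpow_eq_zpow_val, Units.val_mk0] at h2
  have h3 : (((2 : ℚ) ^ m i : ℚ) : K) = ((2 : ℚ) ^ n i : ℚ) := by push_cast; exact h2
  exact zpow_right_injective₀ (by norm_num) (by norm_num) (Rat.cast_injective h3)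

theorem torusCharacter_mem (m : Fin s → ℤ) :
    (torusCharacter K m : Torus K s → Kˣ) ∈ regularUnitSubgroup K (Torus K s) := by
  have : (torusCharacter K m : Torus K s → Kˣ) = ∏ j, (fun t : Torus K s => t j) ^ m j := by
    funext t; simp [torusCharacter_apply]
  rw [this]
  exact prod_mem fun j _ => zpow_mem (coordinate_mem_regularUnitSubgroup j) _

variable (K) (s) (Y : Type w) [AffineVariety K Y]

/-- A Laurent polynomial with coefficients in `K[Y]`, as a function on `T_s × Y`. -/
noncomputable def laurentEval :
    AddMonoidAlgebra (regular (K := K) (X := Y)) (Fin s → ℤ) →+* (Torus K s × Y → K) :=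
  AddMonoidAlgebra.liftNCRingHom
    (((pullback K (Prod.snd : Torus K s × Y → Y)).comp (regular (K := K) (X := Y)).val) :
      regular (K := K) (X := Y) →+* (Torus K s × Y → K))
    { toFun := fun m p => (torusCharacter K m.toAdd p.1 : K)
      map_one' := by ext p; simp [torusCharacter_zero]
      map_mul' := fun m n => by ext p; simp [torusCharacter_add] }
    (fun _ _ => Commute.all _ _)

variable {K s Y}

theorem laurentEval_single (m : Fin s → ℤ) (f : regular (K := K) (X := Y)) (p : Torus K s × Y) :
    laurentEval K s Y (AddMonoidAlgebra.single m f) p =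
      f.1 p.2 * (torusCharacter K m p.1 : K) := by
  rw [laurentEval, AddMonoidAlgebra.liftNCRingHom_single]
  rfl

theorem laurentEval_apply (F : AddMonoidAlgebra (regular (K := K) (X := Y)) (Fin s → ℤ))
    (p : Torus K s × Y) :
    laurentEval K s Y F p = F.coeff.sum fun m f => f.1 p.2 * (torusCharacter K m p.1 : K) := by
  conv_lhs => rw [← F.sum_coeff_single]
  rw [Finsupp.sum, map_sum, Finset.sum_apply]
  exact Finset.sum_congr rfl fun m _ => laurentEval_single m _ p

/-- This is Dedekind's independence of characters, applied at each point of `Y`. -/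
theorem laurentEval_injective [CharZero K] : Function.Injective (laurentEval K s Y) := by
  rw [injective_iff_map_eq_zero]
  intro F hF
  have hind : LinearIndependent K
      (fun (m : Fin s → ℤ) (t : Torus K s) => (torusCharacter K m t : K)) := by
    refine (linearIndependent_monoidHom (Torus K s) K).comp
      (fun m => (Units.coeHom K).comp (torusCharacter K m)) ?_
    intro m n h
    exact torusCharacter_injective (MonoidHom.ext fun t => Units.ext (DFunLike.congr_fun h t))
  ext m y
  by_cases hm : m ∈ F.coeff.support
  · refine linearIndependent_iff'.1 hind F.coeff.support (fun m => (F.coeff m).1 y) ?_ m hm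
    ext t
    have := congrFun hF (t, y)
    rw [laurentEval_apply] at this
    simpa [Finsupp.sum] using this
  · rw [Finsupp.notMem_support_iff.1 hm]; rfl

theorem exists_laurentEval_eq {f : Torus K s × Y → K}
    (hf : f ∈ regular (K := K) (X := Torus K s × Y)) : ∃ F, laurentEval K s Y F = f := by
  have hconst : ∀ r : K, ∃ F, laurentEval K s Y F = algebraMap K _ r := fun r =>
    ⟨AddMonoidAlgebra.single 0 (algebraMap K _ r), by
      ext p; rw [laurentEval_single]; simp [torusCharacter_zero]⟩
  have hadd : ∀ f g : Torus K s × Y → K, (∃ F, laurentEval K s Y F = f) →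
      (∃ F, laurentEval K s Y F = g) → ∃ F, laurentEval K s Y F = f + g := by
    rintro _ _ ⟨F, rfl⟩ ⟨G, rfl⟩
    exact ⟨F + G, map_add _ _ _⟩
  have hmul : ∀ f g : Torus K s × Y → K, (∃ F, laurentEval K s Y F = f) →
      (∃ F, laurentEval K s Y F = g) → ∃ F, laurentEval K s Y F = f * g := by
    rintro _ _ ⟨F, rfl⟩ ⟨G, rfl⟩
    exact ⟨F * G, map_mul _ _ _⟩
  induction hf using Algebra.adjoin_induction with
  | algebraMap r => exact hconst r
  | add f g _ _ hf hg => exact hadd f g hf hg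
  | mul f g _ _ hf hg => exact hmul f g hf hg
  | mem f hf =>
    obtain ⟨f, hf, rfl⟩ | ⟨f, hf, rfl⟩ := hf
    · induction hf using Algebra.adjoin_induction with
      | algebraMap r => exact hconst r
      | add f g _ _ hf hg => rw [map_add]; exact hadd _ _ hf hg
      | mul f g _ _ hf hg => rw [map_mul]; exact hmul _ _ hf hg
      | mem f hf =>
        obtain ⟨i, rfl⟩ | ⟨i, rfl⟩ := hf
        · refine ⟨AddMonoidAlgebra.single (Pi.single i 1) 1, ?_⟩
          ext p
          rw [laurentEval_single, torusCharacter_single]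
          simp [pullback]
        · refine ⟨AddMonoidAlgebra.single (-Pi.single i 1) 1, ?_⟩
          ext p
          have h : torusCharacter K (-Pi.single i 1) p.1 = (p.1 i)⁻¹ := by
            rw [eq_inv_iff_mul_eq_one, ← torusCharacter_single i p.1, ← MonoidHom.mul_apply,
              ← torusCharacter_add, neg_add_cancel, torusCharacter_zero, MonoidHom.one_apply]
          rw [laurentEval_single, h]
          simp [pullback]
    · refine ⟨AddMonoidAlgebra.single 0 ⟨f, hf⟩, ?_⟩
      ext p
      rw [laurentEval_single, torusCharacter_zero]
      simp [pullback]

/-- Over a domain, the units of a Laurent polynomial ring are monomials: two distinct pairs of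
exponents with unique sum would give two distinct nonzero coefficients of the product `1`. -/
theorem exists_single_of_mul_eq_one {R A : Type*} [CommRing R] [IsDomain R] [AddCommGroup A]
    [TwoUniqueSums A] {F G : AddMonoidAlgebra R A} (h : F * G = 1) :
    ∃ m f g, F = AddMonoidAlgebra.single m f ∧ G = AddMonoidAlgebra.single (-m) g ∧ f * g = 1 := by
  classical
  have hF : F ≠ 0 := by rintro rfl; simp at h
  have hG : G ≠ 0 := by rintro rfl; simp at h
  have hF' : 0 < F.coeff.support.card := by
    rw [Finset.card_pos, Finsupp.support_nonempty_iff]; simpa using hF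
  have hG' : 0 < G.coeff.support.card := by
    rw [Finset.card_pos, Finsupp.support_nonempty_iff]; simpa using hG
  have hcard : F.coeff.support.card * G.coeff.support.card ≤ 1 := by
    by_contra! hlt
    obtain ⟨p, hp, q, hq, hpq, hup, huq⟩ := TwoUniqueSums.uniqueAdd_of_one_lt_card hlt
    have hzero : ∀ r ∈ F.coeff.support ×ˢ G.coeff.support,
        UniqueAdd F.coeff.support G.coeff.support r.1 r.2 → r.1 + r.2 = 0 := by
      intro r hr hur
      by_contra hne
      have := AddMonoidAlgebra.coeff_mul_add_of_uniqueAdd hur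
      rw [h, AddMonoidAlgebra.one_def, AddMonoidAlgebra.coeff_single,
        Finsupp.single_eq_of_ne hne] at this
      rw [Finset.mem_product, Finsupp.mem_support_iff, Finsupp.mem_support_iff] at hr
      exact mul_ne_zero hr.1 hr.2 this.symm
    have hqm := Finset.mem_product.1 hq
    obtain ⟨h1, h2⟩ := hup hqm.1 hqm.2 ((hzero q hq huq).trans (hzero p hp hup).symm)
    exact hpq (Prod.ext h1.symm h2.symm)
  have hcF : F.coeff.support.card = 1 := by nlinarith
  have hcG : G.coeff.support.card = 1 := by nlinarith
  obtain ⟨m, f, hf, hFm⟩ := Finsupp.card_support_eq_one'.1 hcF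
  obtain ⟨n, g, hg, hGn⟩ := Finsupp.card_support_eq_one'.1 hcG
  have hF2 : F = AddMonoidAlgebra.single m f := by ext1; simpa using hFm
  have hG2 : G = AddMonoidAlgebra.single n g := by ext1; simpa using hGn
  rw [hF2, hG2, AddMonoidAlgebra.single_mul_single, AddMonoidAlgebra.one_def] at h
  have h' := congrArg AddMonoidAlgebra.coeff h
  rw [AddMonoidAlgebra.coeff_single, AddMonoidAlgebra.coeff_single,
    Finsupp.single_eq_single_iff] at h'
  obtain ⟨hmn, hfg⟩ | ⟨-, h0⟩ := h'
  · obtain rfl : n = -m := (neg_eq_of_add_eq_zero_right hmn).symm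
    exact ⟨m, f, g, hF2, hG2, hfg⟩
  · exact absurd h0 one_ne_zero

/-- Invertible regular functions on `T_s × Y` are monomials with coefficient in `K[Y]^*`. -/
theorem exists_eq_evalUnit_mul_torusCharacter [CharZero K] (hY : IsIrreducibleVariety K Y)
    {P : Torus K s × Y → Kˣ} (hP : P ∈ regularUnitSubgroup K (Torus K s × Y)) :
    ∃ (f : RegularUnits K Y) (m : Fin s → ℤ),
      ∀ t y, P (t, y) = evalUnit f y * torusCharacter K m t := by
  have := hY.isDomain
  obtain ⟨F, hF⟩ := exists_laurentEval_eq hP.1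
  obtain ⟨G, hG⟩ := exists_laurentEval_eq hP.2
  have hFG : F * G = 1 := by
    apply laurentEval_injective
    rw [map_mul, hF, hG, map_one]
    ext p
    simp
  obtain ⟨m, f, g, rfl, rfl, hfg⟩ := exists_single_of_mul_eq_one hFG
  refine ⟨⟨f, g, hfg, by rw [mul_comm, hfg]⟩, m, fun t y => ?_⟩
  ext
  rw [← congrFun hF (t, y), laurentEval_single]
  rfl

theorem eq_zero_or_eq_zero_of_mul_eq_zero_torus [CharZero K] (hY : IsIrreducibleVariety K Y)
    {f g : Torus K s × Y → K} (hf : f ∈ regular (K := K) (X := Torus K s × Y))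
    (hg : g ∈ regular (K := K) (X := Torus K s × Y)) (hfg : f * g = 0) : f = 0 ∨ g = 0 := by
  have := hY.isDomain
  obtain ⟨F, rfl⟩ := exists_laurentEval_eq hf
  obtain ⟨G, rfl⟩ := exists_laurentEval_eq hg
  rw [← map_mul] at hfg
  have h : F * G = 0 := laurentEval_injective (hfg.trans (map_zero _).symm)
  refine (mul_eq_zero.1 h).imp ?_ ?_ <;> rintro rfl <;> exact map_zero _

end Laurent

/-! ### Torus actions and the normal form of automorphisms -/

section TorusActions

variable {K : Type u} [Field K] {Y : Type w} [AffineVariety K Y]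

/-- The regular functions on `T_s` have no zero divisors, so a neighbourhood of `1` is dense: a
character that is trivial there is trivial. The variety `Y` only serves to obtain the absence of
zero divisors from that on `T_s × Y`. -/
theorem torusCharacter_eq_one_of_isOpen [CharZero K] {s : ℕ} (hY : IsIrreducibleVariety K Y)
    {U : Set (Torus K s)} (hU : @IsOpen _ (zariskiTopology K (Torus K s)) U) (h1 : 1 ∈ U)
    {m : Fin s → ℤ} (hm : ∀ t ∈ U, torusCharacter K m t = 1) (t : Torus K s) :
    torusCharacter K m t = 1 := by
  obtain ⟨S, hS, hUS⟩ : IsZariskiClosed K Uᶜ := hU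
  obtain ⟨f, hf, hf1⟩ : ∃ f ∈ S, f 1 ≠ 0 := by
    by_contra! hcon
    have : (1 : Torus K s) ∈ Uᶜ := hUS ▸ hcon
    exact this h1
  obtain ⟨y⟩ := hY.nonempty
  have hreg : ((fun p : Torus K s × Y => (torusCharacter K m p.1 : K)) - 1) ∈
      regular (K := K) (X := Torus K s × Y) :=
    sub_mem (comp_mem_regularUnitSubgroup isRegularMap_fst (torusCharacter_mem m)).1 (one_mem _)
  have hmul : (f ∘ Prod.fst) *
      ((fun p : Torus K s × Y => (torusCharacter K m p.1 : K)) - 1) = 0 := by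
    ext p
    by_cases hp : p.1 ∈ U
    · simp [hm p.1 hp]
    · have : p.1 ∈ Uᶜ := hp
      rw [hUS] at this
      simp [this f hf]
  obtain h | h := eq_zero_or_eq_zero_of_mul_eq_zero_torus hY
    (isRegularMap_fst f (hS hf)) hreg hmul
  · exact absurd (congrFun h (1, y)) hf1
  · have := congrFun h (t, y)
    ext
    simpa [sub_eq_zero] using this

/-- If `Aut(Y)` is discrete, then `T_s` acts trivially on `Y` through translations by characters
of an ambient torus, because `T_s` is connected. -/
theorem torusCharacter_eq_one_of_hasDiscreteAut [CharZero K] {s d : ℕ}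
    (hY : IsIrreducibleVariety K Y) (hdisc : HasDiscreteAut K Y) {ι : Y → Torus K d}
    (hι : IsClosedImmersion K ι) (B : Fin d → Fin s → ℤ) (a : Torus K s → Y → Y)
    (ha : ∀ t y k, ι (a t y) k = torusCharacter K (B k) t * ι y k) (k : Fin d) (t : Torus K s) :
    torusCharacter K (B k) t = 1 := by
  have hcoord : ∀ k, (fun y => ι y k) ∈ regularUnitSubgroup K Y :=
    isRegularMap_torus_iff.1 hι.isRegularMap
  have hinv : ∀ t y, a t⁻¹ (a t y) = y := by
    intro t y
    apply hι.injective
    funext k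
    rw [ha, ha, map_inv, inv_mul_cancel_left]
  have hreg : ∀ t, IsRegularMap K (a t) := by
    intro t
    apply hι.isRegularMap_of_comp
    rw [isRegularMap_torus_iff]
    intro k
    simp only [Function.comp_apply, ha]
    -- A constant with values in `K^*` is a coordinate of a constant map to `T_1`.
    exact mul_mem (isRegularMap_torus_iff.1
      (isRegularMap_const (X := Y) (fun _ : Fin 1 => torusCharacter K (B k) t)) 0) (hcoord k)
  have hfam : IsRegularMap K (fun p : Torus K s × Y => a p.1 p.2) := by
    apply hι.isRegularMap_of_comp
    rw [isRegularMap_torus_iff]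
    intro k
    simp only [Function.comp_apply, ha]
    exact mul_mem (comp_mem_regularUnitSubgroup isRegularMap_fst (torusCharacter_mem (B k)))
      (comp_mem_regularUnitSubgroup isRegularMap_snd (hcoord k))
  let φ : Torus K s → Aut K Y := fun t =>
    ⟨⟨a t, a t⁻¹, hinv t, fun y => by simpa using hinv t⁻¹ y⟩, hreg t, hreg t⁻¹⟩
  have hinvreg : IsRegularMap K (fun t : Torus K s => t⁻¹) :=
    isRegularMap_torus_iff.2 fun i => inv_mem (coordinate_mem_regularUnitSubgroup i)
  have hφ : IsAlgebraicFamily K φ := by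
    refine ⟨hfam, ?_⟩
    exact hfam.comp (isRegularMap_prodMk (hinvreg.comp isRegularMap_fst) isRegularMap_snd)
  have hopen : @IsOpen _ (autTopology K Y) {(1 : Aut K Y)} :=
    @isOpen_discrete _ (autTopology K Y) hdisc _
  obtain ⟨y⟩ := hY.nonempty
  have htriv : ∀ t, φ t = 1 → ∀ k, torusCharacter K (B k) t = 1 := by
    intro t ht k
    have h : a t y = y := congrArg (fun g : Aut K Y => (g : Equiv.Perm Y) y) ht
    have := ha t y k
    rw [h] at this
    exact mul_eq_right.1 this.symm
  refine torusCharacter_eq_one_of_isOpen hY (hopen _ φ hφ) ?_ (fun t ht => htriv t ht k) t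
  change φ 1 = 1
  ext y
  apply hι.injective
  funext k
  change ι (a 1 y) k = ι y k
  rw [ha, map_one, one_mul]

/-- The torus coordinates of `F` are invertible functions, hence monomials over `K[Y]`. The
`Y`-component does not depend on the torus, since otherwise `T_s` would act on `Y` non-trivially
by translations of the ambient torus of `Y`. -/
theorem exists_normal_form [CharZero K] {s : ℕ} (hY : IsToral K Y) (hdisc : HasDiscreteAut K Y)
    {F : Torus K s × Y → Torus K s × Y} (hF : IsRegularMap K F) (hsurj : Function.Surjective F) :
    ∃ (f : Fin s → RegularUnits K Y) (A : Matrix (Fin s) (Fin s) ℤ) (g : Y → Y),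
      IsRegularMap K g ∧
      ∀ t y, F (t, y) = (fun i => evalUnit (f i) y * torusCharacter K (A i) t, g y) := by
  obtain ⟨hirr, d, ι, hι⟩ := hY
  have h1 : IsRegularMap K (fun p => (F p).1) := isRegularMap_fst.comp hF
  have h2 : IsRegularMap K (fun p => (F p).2) := isRegularMap_snd.comp hF
  choose f A hfA using fun i =>
    exists_eq_evalUnit_mul_torusCharacter hirr (isRegularMap_torus_iff.1 h1 i)
  choose v B hvB using fun k =>
    exists_eq_evalUnit_mul_torusCharacter hirr
      (isRegularMap_torus_iff.1 (hι.isRegularMap.comp h2) k)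
  -- `F (G y)` lies over `y`; moving the torus coordinate of `G y` by `t` moves `y` by the
  -- translation `(χ_{B k}(t))_k` of the ambient torus, which therefore preserves `Y`.
  choose G hG using fun y => hsurj (1, y)
  have hB := torusCharacter_eq_one_of_hasDiscreteAut hirr hdisc hι B
    (fun t y => (F (t * (G y).1, (G y).2)).2) (by
      intro t y k
      have h : ι y k = evalUnit (v k) (G y).2 * torusCharacter K (B k) (G y).1 := by
        rw [← hvB]; exact congrArg (fun q : Torus K s × Y => ι q.2 k) (hG y).symm
      rw [h, mul_left_comm, ← map_mul, ← hvB]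
      rfl)
  refine ⟨f, A, fun y => (F (1, y)).2, ?_, fun t y => Prod.ext ?_ ?_⟩
  · exact h2.comp (isRegularMap_prodMk (isRegularMap_const 1) isRegularMap_id)
  · funext i; exact hfA i t y
  · apply hι.injective
    funext k
    have e1 := hvB k t y
    have e2 := hvB k 1 y
    rw [hB k t, mul_one] at e1
    rw [hB k 1, mul_one] at e2
    exact e1.trans e2.symm

end TorusActions

/-! ### The isomorphism of groups -/

section Group

variable {K : Type u} [Field K] {Y : Type w} [AffineVariety K Y] {s : ℕ}

theorem torusCharacter_comp_mul (A B : Matrix (Fin s) (Fin s) ℤ) (u : Fin s → Kˣ)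
    (t : Torus K s) (i : Fin s) :
    torusCharacter K (A i) (fun j => u j * torusCharacter K (B j) t) =
      torusCharacter K (A i) u * torusCharacter K ((A * B) i) t := by
  rw [show (fun j => u j * torusCharacter K (B j) t) = u * matrixPow B t from rfl, map_mul]
  congr 1
  exact (congrFun (matrixPow_mul A B t) i).symm

theorem evalUnit_matrixPow (A : Matrix (Fin s) (Fin s) ℤ) (f : Fin s → RegularUnits K Y)
    (i : Fin s) (y : Y) :
    evalUnit (matrixPow A f i) y = torusCharacter K (A i) fun j => evalUnit (f j) y := by
  simp only [matrixPow, torusCharacter_apply]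
  change evalUnitHom y _ = ∏ j, (evalUnitHom y (f j)) ^ A i j
  rw [map_prod]
  simp only [map_zpow]

/-- The map `(t, y) ↦ ((f_i(g y) t^{A_i})_i, g y)`, that is, `g` followed by the matrix `A`
followed by multiplication by `f`. This order makes composition of maps correspond to
multiplication in the semidirect product. -/
def normalMap (f : Fin s → RegularUnits K Y) (A : Matrix (Fin s) (Fin s) ℤ) (g : Y → Y) :
    Torus K s × Y → Torus K s × Y :=
  fun p => (fun i => evalUnit (f i) (g p.2) * torusCharacter K (A i) p.1, g p.2)

theorem isRegularMap_normalMap (f : Fin s → RegularUnits K Y) (A : Matrix (Fin s) (Fin s) ℤ)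
    {g : Y → Y} (hg : IsRegularMap K g) : IsRegularMap K (normalMap f A g) := by
  have hg2 : IsRegularMap K (fun p : Torus K s × Y => g p.2) := hg.comp isRegularMap_snd
  refine isRegularMap_prodMk (isRegularMap_torus_iff.2 fun i => ?_) hg2
  exact mul_mem (comp_mem_regularUnitSubgroup hg2 (evalUnit_mem (f i)))
    (comp_mem_regularUnitSubgroup isRegularMap_fst (torusCharacter_mem (A i)))

variable (σ : RegularUnits K Y ≃* UnitClassGroup K Y × Kˣ)

/-- The group `Aut(Y) ⋉ (GL_s(ℤ) ⋉ (E(Y) × K^*)^s)`. -/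
abbrev NormalGroup (s : ℕ) (σ : RegularUnits K Y ≃* UnitClassGroup K Y × Kˣ) :=
  GLSemidirect s (UnitClassGroup K Y × Kˣ) ⋊[inducedAction s (autSplit K Y σ)] Aut K Y

/-- The map of `T_s × Y` to itself given by an element of `NormalGroup s σ`. -/
def normalAction (x : NormalGroup s σ) : Torus K s × Y → Torus K s × Y :=
  normalMap (fun i => σ.symm (x.left.left i)) x.left.right.1 (x.right : Equiv.Perm Y)

theorem isRegularMap_normalAction (x : NormalGroup s σ) : IsRegularMap K (normalAction σ x) :=
  isRegularMap_normalMap _ _ x.right.2.1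

theorem normalAction_one (p : Torus K s × Y) : normalAction σ (1 : NormalGroup s σ) p = p := by
  refine Prod.ext ?_ rfl
  funext i
  change evalUnit (σ.symm 1) p.2 * matrixPow 1 p.1 i = p.1 i
  rw [matrixPow_one, map_one]
  exact one_mul _

theorem normalAction_mul (x x' : NormalGroup s σ) (p : Torus K s × Y) :
    normalAction σ (x * x') p = normalAction σ x (normalAction σ x' p) := by
  obtain ⟨t, y⟩ := p
  refine Prod.ext ?_ rfl
  funext i
  set g := x.right
  set g' := x'.right
  change evalUnit (σ.symm (x.left.left i * matrixPow x.left.right.1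
      (fun j => σ (autUnits K Y g (σ.symm (x'.left.left j)))) i))
      ((g : Equiv.Perm Y) ((g' : Equiv.Perm Y) y)) *
      torusCharacter K ((x.left.right.1 * x'.left.right.1) i) t =
    evalUnit (σ.symm (x.left.left i)) ((g : Equiv.Perm Y) ((g' : Equiv.Perm Y) y)) *
      torusCharacter K (x.left.right.1 i) (fun j =>
        evalUnit (σ.symm (x'.left.left j)) ((g' : Equiv.Perm Y) y) *
          torusCharacter K (x'.left.right.1 j) t)
  have h : σ.symm (matrixPow x.left.right.1
      (fun j => σ (autUnits K Y g (σ.symm (x'.left.left j)))) i) =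
      matrixPow x.left.right.1 (fun j => autUnits K Y g (σ.symm (x'.left.left j))) i := by
    simp [matrixPow, map_prod, map_zpow]
  rw [torusCharacter_comp_mul, map_mul, evalUnit_mul, h, evalUnit_matrixPow, mul_assoc]
  simp [evalUnit_autUnits]

variable {X : Type v} [AffineVariety K X]

/-- The homomorphism from `NormalGroup s σ` to the automorphism group of a variety isomorphic to
`T_s × Y`. -/
def normalHom (e : X ≃ Torus K s × Y) (he : IsRegularMap K e) (he' : IsRegularMap K e.symm) :
    NormalGroup s σ →* Aut K X where
  toFun x :=
    ⟨⟨fun p => e.symm (normalAction σ x (e p)), fun p => e.symm (normalAction σ x⁻¹ (e p)),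
      fun p => by simp [← normalAction_mul, normalAction_one],
      fun p => by simp [← normalAction_mul, normalAction_one]⟩,
      (he'.comp (isRegularMap_normalAction σ x)).comp he,
      (he'.comp (isRegularMap_normalAction σ x⁻¹)).comp he⟩
  map_one' := by
    ext p
    simp [normalAction_one]
  map_mul' x x' := by
    ext p
    simp [normalAction_mul]

theorem apply_normalHom_symm_apply (e : X ≃ Torus K s × Y) (he : IsRegularMap K e)
    (he' : IsRegularMap K e.symm) (x : NormalGroup s σ) (p : Torus K s × Y) :
    e ((normalHom σ e he he' x : Equiv.Perm X) (e.symm p)) = normalAction σ x p := by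
  simp [normalHom]

theorem normalMap_injective [CharZero K] [Nonempty Y] {f f' : Fin s → RegularUnits K Y}
    {A A' : Matrix (Fin s) (Fin s) ℤ} {g g' : Y → Y} (hg : Function.Surjective g)
    (h : normalMap f A g = normalMap f' A' g') : f = f' ∧ A = A' ∧ g = g' := by
  obtain rfl : g = g' := by
    funext y; exact congrArg Prod.snd (congrFun h (1, y))
  have hval : ∀ i t y, evalUnit (f i) (g y) * torusCharacter K (A i) t =
      evalUnit (f' i) (g y) * torusCharacter K (A' i) t := fun i t y =>
    congrFun (congrArg Prod.fst (congrFun h (t, y))) i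
  have hf : f = f' := by
    funext i
    apply evalUnit_injective
    funext y
    obtain ⟨y, rfl⟩ := hg y
    simpa using hval i 1 y
  subst hf
  refine ⟨rfl, ?_, rfl⟩
  funext i
  apply torusCharacter_injective (K := K)
  refine MonoidHom.ext fun t => ?_
  exact mul_left_cancel (hval i t (g (Classical.arbitrary Y)))

theorem normalHom_injective [CharZero K] [Nonempty Y] (e : X ≃ Torus K s × Y)
    (he : IsRegularMap K e) (he' : IsRegularMap K e.symm) :
    Function.Injective (normalHom σ e he he') := by
  intro x x' h
  have hmap : normalAction σ x = normalAction σ x' := by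
    funext p
    rw [← apply_normalHom_symm_apply σ e he he', h, apply_normalHom_symm_apply]
  obtain ⟨h1, h2, h3⟩ := normalMap_injective (x.right : Equiv.Perm Y).surjective hmap
  refine SemidirectProduct.ext (SemidirectProduct.ext ?_ (Units.ext h2))
    (Subtype.ext (DFunLike.coe_injective h3))
  funext i
  exact σ.symm.injective (congrFun h1 i)

theorem normalMap_comp (f f' : Fin s → RegularUnits K Y) (A A' : Matrix (Fin s) (Fin s) ℤ)
    (g g' : Y → Y) (t : Torus K s) (y : Y) :
    normalMap f A g (normalMap f' A' g' (t, y)) =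
      (fun i => evalUnit (f i) (g (g' y)) * (torusCharacter K (A i)
        (fun j => evalUnit (f' j) (g' y)) * torusCharacter K ((A * A') i) t), g (g' y)) := by
  refine Prod.ext ?_ rfl
  funext i
  exact congrArg (evalUnit (f i) (g (g' y)) * ·) (torusCharacter_comp_mul A A' _ t i)

/-- If the composition of two maps in normal form is the identity, so is the product of their
matrices: the value of a character at `t` is recovered by comparing with the value at `1`. -/
theorem mul_eq_one_of_normalMap_comp [CharZero K] [Nonempty Y] {f f' : Fin s → RegularUnits K Y}
    {A A' : Matrix (Fin s) (Fin s) ℤ} {g g' : Y → Y}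
    (h : ∀ p, normalMap f A g (normalMap f' A' g' p) = p) : A * A' = 1 := by
  obtain ⟨y⟩ := ‹Nonempty Y›
  funext i
  apply torusCharacter_injective (K := K)
  refine MonoidHom.ext fun t => ?_
  have key : ∀ t, evalUnit (f i) (g (g' y)) * (torusCharacter K (A i)
        (fun j => evalUnit (f' j) (g' y)) * torusCharacter K ((A * A') i) t) = t i := fun t => by
    have := h (t, y)
    rw [normalMap_comp] at this
    exact congrFun (congrArg Prod.fst this) i
  have h1 := key 1
  rw [map_one, mul_one] at h1
  have ht := key t
  rw [← mul_assoc, h1, Pi.one_apply, one_mul] at ht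
  rw [ht]
  exact (congrFun (matrixPow_one t) i).symm

theorem exists_eq_normalMap [CharZero K] (hY : IsToral K Y) (hdisc : HasDiscreteAut K Y)
    {F F' : Torus K s × Y → Torus K s × Y} (hF : IsRegularMap K F) (hF' : IsRegularMap K F')
    (h : ∀ p, F (F' p) = p) (h' : ∀ p, F' (F p) = p) :
    ∃ (f : Fin s → RegularUnits K Y) (A : GL (Fin s) ℤ) (g : Aut K Y),
      F = normalMap f A.1 (g : Equiv.Perm Y) := by
  have : Nonempty Y := hY.1.nonempty
  obtain ⟨f, A, g, hg, hFeq⟩ := exists_normal_form hY hdisc hF fun p => ⟨_, h p⟩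
  obtain ⟨f', A', g', hg', hFeq'⟩ := exists_normal_form hY hdisc hF' fun p => ⟨_, h' p⟩
  have hgg' : ∀ y, g (g' y) = y := fun y => by
    have := h (1, y)
    rw [hFeq', hFeq] at this
    exact congrArg Prod.snd this
  have hg'g : ∀ y, g' (g y) = y := fun y => by
    have := h' (1, y)
    rw [hFeq, hFeq'] at this
    exact congrArg Prod.snd this
  -- The units of the normal form are evaluated at `g y` rather than at `y`.
  have hshift : ∀ {g g' : Y → Y}, (∀ y, g' (g y) = y) → IsRegularMap K g' →
      ∀ f : Fin s → RegularUnits K Y, ∃ f₁ : Fin s → RegularUnits K Y,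
        ∀ i y, evalUnit (f₁ i) (g y) = evalUnit (f i) y := by
    intro g g' hinv hg' f
    choose f₁ hf₁ using fun i => exists_evalUnit_eq
      (comp_mem_regularUnitSubgroup hg' (evalUnit_mem (f i)))
    refine ⟨f₁, fun i y => ?_⟩
    rw [hf₁, Function.comp_apply, hinv]
  obtain ⟨f₁, hf₁⟩ := hshift hg'g hg' f
  obtain ⟨f₁', hf₁'⟩ := hshift hgg' hg f'
  have hFn : F = normalMap f₁ A g := by
    funext ⟨t, y⟩; simp only [hFeq, normalMap, hf₁]
  have hFn' : F' = normalMap f₁' A' g' := by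
    funext ⟨t, y⟩; simp only [hFeq', normalMap, hf₁']
  refine ⟨f₁, ⟨A, A', mul_eq_one_of_normalMap_comp (hFn ▸ hFn' ▸ h),
    mul_eq_one_of_normalMap_comp (hFn ▸ hFn' ▸ h')⟩, ⟨⟨g, g', hg'g, hgg'⟩, hg, hg'⟩, hFn⟩

theorem normalHom_surjective [CharZero K] (hY : IsToral K Y) (hdisc : HasDiscreteAut K Y)
    (e : X ≃ Torus K s × Y) (he : IsRegularMap K e) (he' : IsRegularMap K e.symm) :
    Function.Surjective (normalHom σ e he he') := by
  intro φ
  obtain ⟨f, A, g, hfAg⟩ := exists_eq_normalMap (s := s) hY hdisc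
    (F := e ∘ (φ : Equiv.Perm X) ∘ e.symm) (F' := e ∘ (φ : Equiv.Perm X).symm ∘ e.symm)
    ((he.comp φ.2.1).comp he') ((he.comp φ.2.2).comp he') (by simp) (by simp)
  refine ⟨⟨⟨fun i => σ (f i), A⟩, g⟩, ?_⟩
  ext p
  have h := congrFun hfAg (e p)
  simp only [Function.comp_apply, Equiv.symm_apply_apply] at h
  apply e.injective
  rw [h]
  simp [normalHom, normalAction]

end Group

end AffineVariety

theorem theorem2 {K : Type u} [Field K] [IsAlgClosed K] [CharZero K] [Uncountable K] (s : ℕ)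
    {X : Type v} {Y : Type w} [AffineVariety K X] [AffineVariety K Y]
    (hY : IsToral K Y) (hdisc : HasDiscreteAut K Y)
    (e : X ≃ Torus K s × Y) (he : IsRegularMap K e) (he' : IsRegularMap K e.symm) :
    (∃ σ : RegularUnits K Y ≃* UnitClassGroup K Y × Kˣ, IsSplitting K Y σ) ∧
    ∀ σ : RegularUnits K Y ≃* UnitClassGroup K Y × Kˣ, IsSplitting K Y σ →
      ∃ Ψ : Aut K X ≃*
          GLSemidirect s (UnitClassGroup K Y × Kˣ) ⋊[inducedAction s (autSplit K Y σ)] Aut K Y,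
        (∀ (g : Aut K Y) (t : Torus K s) (y : Y),
          e ((Ψ.symm (SemidirectProduct.inr g) : Equiv.Perm X) (e.symm (t, y))) =
            (t, (g : Equiv.Perm Y) y)) ∧
        (∀ (A : GL (Fin s) ℤ) (t : Torus K s) (y : Y),
          e ((Ψ.symm (SemidirectProduct.inl (SemidirectProduct.inr A)) : Equiv.Perm X)
              (e.symm (t, y))) =
            (fun i => ∏ j, t j ^ (A.1 i j), y)) ∧
        (∀ (f : Fin s → RegularUnits K Y) (t : Torus K s) (y : Y),
          e ((Ψ.symm (SemidirectProduct.inl (SemidirectProduct.inl fun i => σ (f i))) :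
              Equiv.Perm X) (e.symm (t, y))) =
            (fun i => evalUnit (f i) y * t i, y)) := by
  have : Nonempty Y := hY.1.nonempty
  refine ⟨exists_isSplitting, fun σ _ => ?_⟩
  refine ⟨(MulEquiv.ofBijective (normalHom σ e he he')
    ⟨normalHom_injective σ e he he', normalHom_surjective σ hY hdisc e he he'⟩).symm, ?_, ?_, ?_⟩
  · intro g t y
    refine (apply_normalHom_symm_apply σ e he he' _ _).trans (Prod.ext ?_ rfl)
    funext i
    change evalUnit (σ.symm 1) _ * matrixPow 1 t i = t i
    rw [map_one, matrixPow_one]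
    exact one_mul _
  · intro A t y
    refine (apply_normalHom_symm_apply σ e he he' _ _).trans (Prod.ext ?_ rfl)
    funext i
    change evalUnit (σ.symm 1) _ * _ = _
    rw [map_one]
    exact one_mul _
  · intro f t y
    refine (apply_normalHom_symm_apply σ e he he' _ _).trans (Prod.ext ?_ rfl)
    funext i
    change evalUnit (σ.symm (σ (f i))) y * matrixPow 1 t i = _
    rw [MulEquiv.symm_apply_apply, matrixPow_one]
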